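/- Let $p$ be an odd prime, $\omega=e^{2\pi i/p}$, and let $\{|q\rangle\}_{q\in\mathbb Z_p}$ be the standard basis of $\mathbb C^p$. For $\xi:\mathbb Z_p\to U(1)$ let $S_\xi|q\rangle=\xi(q)|q\rangle$, and for $\sigma$ in the group $S_p$ of permutations of $\mathbb Z_p$ let $P_\sigma|q\rangle=|\sigma(q)\rangle$. Let $T_{(p)}=\{S_\xi : \det S_\xi=1,\ S_\xi^p=\mathbb 1\}$ be the $p$-torsion part of the diagonal torus of $SU(p)$, and let $L$ be the split extension $1\to T_{(p)}\to L\to S_p\to 1$, realised as the group of unitary matrices $$L=\{\varepsilon(\sigma)\,S_\xi P_\sigma : S_\xi\in T_{(p)},\ \sigma\in S_p\},$$ where $\varepsilon:S_p\to\{\pm1\}$ is a fixed homomorphism, either trivial (so that $S_p$ acts by permutation matrices) or the sign (so that $L\le SU(p)$). For $n\ge 1$ let $L^{\otimes n}=\{M_1\otimes\cdots\otimes M_n : M_i\in L\}$, a group of unitary operators on $(\mathbb C^p)^{\otimes n}$. Let $A\in\mathrm{Mat}_{r,s}(\mathbb Z_p)$ and $b\in\mathbb Z_p^r$. The solution group $\Gamma$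 of the linear constraint system (LCS) $Ax=b \bmod p$ is the group generated by $J,x_1,\dots,x_s$ subject to the relations $J^p=x_k^p=1$ and $[J,x_k]=1$ for all $k$; $[x_k,x_l]=1$ whenever $A_{jk}\ne0\ne A_{jl}$ for some $j$; and $\prod_{k=1}^s x_k^{A_{jk}}=J^{b_j}$ for all $j$. A quantum solution in $L^{\otimes n}$ is a group homomorphism $\eta:\Gamma\to L^{\otimes n}$ with $\eta(J)=\omega\mathbb 1$; equivalently, an assignment of operators $x_k\in L^{\otimes n}$ with $x_k^p=\mathbb 1$, commuting whenever they occur in a common row of $A$, and with $\prod_k x_k^{A_{jk}}=\omega^{b_j}\mathbb 1$ for all $j$. A classical solution is a group homomorphism $\eta:\Gamma\to\mathbb Z_p$ with $\eta(J)=1$; equivalently, a vector $\tilde x\in\mathbb Z_p^s$ with $A\tilde x=b$. Then, for every $n\ge1$, every LCS $Ax=b\bmod p$ and either choice of $\varepsilon$, the LCS has a quantum solution $\eta:\Gamma\to L^{\otimes n}$ if and only if it has a classical solution $\eta:\Gamma\to\mathbb Z_p$. -/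

import Mathlib

open scoped Matrix

noncomputable section

namespace LCS

/-! ### Linear constraint systems and their solution groups -/

/-- The primitive root of unity `ω = exp (2πi/p)`. -/
def omega (p : ℕ) : ℂ := Complex.exp (2 * Real.pi * Complex.I / p)

/-- Generators of the solution group: the central element `J` and one generator per variable. -/
inductive Gen (s : ℕ) : Type
  | J : Gen s
  | x : Fin s → Gen s

section SolutionGroup

variable {p r s : ℕ} (A : Matrix (Fin r) (Fin s) (ZMod p)) (b : Fin r → ZMod p)

/-- The defining relators of the solution group of `A x = b` over `ℤ_p`:
`J` and all `x k` are `p`-torsion, `J` is central, variables in a common row of `A` commute, and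
`∏ₖ (x k) ^ A j k = J ^ b j` for every row `j`. -/
inductive IsRelator : FreeGroup (Gen s) → Prop
  | J_torsion : IsRelator (FreeGroup.of Gen.J ^ p)
  | x_torsion (k : Fin s) : IsRelator (FreeGroup.of (Gen.x k) ^ p)
  | J_central (k : Fin s) :
      IsRelator (FreeGroup.of Gen.J * FreeGroup.of (Gen.x k) * (FreeGroup.of Gen.J)⁻¹ *
        (FreeGroup.of (Gen.x k))⁻¹)
  | x_comm (j : Fin r) (k l : Fin s) (hk : A j k ≠ 0) (hl : A j l ≠ 0) :
      IsRelator (FreeGroup.of (Gen.x k) * FreeGroup.of (Gen.x l) * (FreeGroup.of (Gen.x k))⁻¹ *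
        (FreeGroup.of (Gen.x l))⁻¹)
  | row (j : Fin r) :
      IsRelator ((List.ofFn fun k : Fin s => FreeGroup.of (Gen.x k) ^ (A j k).val).prod *
        (FreeGroup.of Gen.J ^ (b j).val)⁻¹)

/-- The solution group `Γ` of the linear constraint system `A x = b` over `ℤ_p`. -/
abbrev SolutionGroup : Type := PresentedGroup {w : FreeGroup (Gen s) | IsRelator A b w}

/-- The distinguished central element `J` of the solution group. -/
def SolutionGroup.J : SolutionGroup A b := PresentedGroup.of Gen.J

variable {A b}

/-- A homomorphism `η : Γ → G` into a group `G` of unitary operators is a *quantum solution* if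
`η J = ω 𝟙`. -/
def IsQuantumSolution {ι : Type} [Fintype ι] [DecidableEq ι]
    {G : Subgroup (Matrix.unitaryGroup ι ℂ)} (η : SolutionGroup A b →* G) : Prop :=
  ((η (SolutionGroup.J A b) : Matrix.unitaryGroup ι ℂ) : Matrix ι ι ℂ) = omega p • 1

/-- A homomorphism `η : Γ → ℤ_p` is a *classical solution* if `η J = 1` (the generator `1 ∈ ℤ_p`
which corresponds to `ω`). -/
def IsClassicalSolution (η : SolutionGroup A b →* Multiplicative (ZMod p)) : Prop :=
  η (SolutionGroup.J A b) = Multiplicative.ofAdd 1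

/-- A homomorphism from the solution group to `G` which maps `J` to `z` is the same as an assignment
of elements of `G` to the variables that satisfies the relations with `J` replaced by `z`. -/
theorem exists_hom_iff {G : Type*} [Group G] (z : G) :
    (∃ η : SolutionGroup A b →* G, η (SolutionGroup.J A b) = z) ↔
      z ^ p = 1 ∧ ∃ x : Fin s → G, (∀ k, x k ^ p = 1) ∧ (∀ k, Commute z (x k)) ∧
        (∀ j k l, A j k ≠ 0 → A j l ≠ 0 → Commute (x k) (x l)) ∧
        ∀ j, (List.ofFn fun k => x k ^ (A j k).val).prod = z ^ (b j).val := by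
  have hcomm : ∀ g h : G, g * h * g⁻¹ * h⁻¹ = 1 ↔ Commute g h := fun g h => by
    rw [mul_inv_eq_one, mul_inv_eq_iff_eq_mul]
    rfl
  have hlift : ∀ f : Gen s → G, (∀ w, IsRelator A b w → FreeGroup.lift f w = 1) ↔
      f .J ^ p = 1 ∧ (∀ k, f (.x k) ^ p = 1) ∧ (∀ k, Commute (f .J) (f (.x k))) ∧
        (∀ j k l, A j k ≠ 0 → A j l ≠ 0 → Commute (f (.x k)) (f (.x l))) ∧
        ∀ j, (List.ofFn fun k => f (.x k) ^ (A j k).val).prod = f .J ^ (b j).val := by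
    intro f
    constructor
    · intro h
      refine ⟨?_, fun k => ?_, fun k => ?_, fun j k l hk hl => ?_, fun j => ?_⟩
      · simpa using h _ .J_torsion
      · simpa using h _ (.x_torsion k)
      · simpa [hcomm] using h _ (.J_central k)
      · simpa [hcomm] using h _ (.x_comm j k l hk hl)
      · have h := h _ (.row j)
        rw [map_mul, map_inv, mul_inv_eq_one, map_pow, map_list_prod, List.map_ofFn] at h
        simpa [Function.comp_def] using h
    · rintro ⟨h1, h2, h3, h4, h5⟩ w hw
      cases hw with
      | J_torsion => simpa using h1
      | x_torsion k => simpa using h2 k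
      | J_central k => simpa [hcomm] using h3 k
      | x_comm j k l hk hl => simpa [hcomm] using h4 j k l hk hl
      | row j =>
        rw [map_mul, map_inv, mul_inv_eq_one, map_pow, map_list_prod, List.map_ofFn]
        simpa [Function.comp_def] using h5 j
  constructor
  · rintro ⟨η, rfl⟩
    obtain ⟨h1, h2⟩ := (hlift fun g => η (PresentedGroup.of g)).1 fun w hw => by
      have e : FreeGroup.lift (fun g => η (PresentedGroup.of g)) =
          η.comp (PresentedGroup.mk {w : FreeGroup (Gen s) | IsRelator A b w}) := by
        ext g
        simp [PresentedGroup.of]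
      rw [e, MonoidHom.comp_apply,
        PresentedGroup.one_of_mem (show w ∈ {w | IsRelator A b w} from hw), map_one]
    exact ⟨h1, _, h2⟩
  · rintro ⟨hz, x, hx⟩
    have hf := (hlift fun g => Gen.casesOn g z x).2 ⟨hz, hx⟩
    exact ⟨PresentedGroup.toGroup hf, PresentedGroup.toGroup.of hf⟩

/-- If `ω 𝟙 ∈ G`, a quantum solution in `G` is the same as an assignment of `p`-torsion operators
in `G` to the variables such that operators in a common row commute and
`∏ₖ (x k) ^ A j k = ω ^ b j 𝟙` for all rows `j`. -/
theorem exists_isQuantumSolution_iff [NeZero p] {ι : Type} [Fintype ι] [DecidableEq ι]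
    {G : Subgroup (Matrix.unitaryGroup ι ℂ)} (hG : ∃ z ∈ G, (z : Matrix ι ι ℂ) = omega p • 1) :
    (∃ η : SolutionGroup A b →* G, IsQuantumSolution η) ↔
      ∃ x : Fin s → G, (∀ k, x k ^ p = 1) ∧
        (∀ j k l, A j k ≠ 0 → A j l ≠ 0 → Commute (x k) (x l)) ∧
        ∀ j, ((((List.ofFn fun k => x k ^ (A j k).val).prod : G) : Matrix.unitaryGroup ι ℂ) :
          Matrix ι ι ℂ) = omega p ^ (b j).val • 1 := by
  obtain ⟨z, hzG, hz⟩ := hG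
  have inj : ∀ {g h : G}, ((g : Matrix.unitaryGroup ι ℂ) : Matrix ι ι ℂ) =
      ((h : Matrix.unitaryGroup ι ℂ) : Matrix ι ι ℂ) ↔ g = h :=
    fun {g h} => ⟨fun e => Subtype.ext (Subtype.ext e), fun e => by rw [e]⟩
  have hpow : ∀ m : ℕ, ((((⟨z, hzG⟩ : G) ^ m : G) : Matrix.unitaryGroup ι ℂ) : Matrix ι ι ℂ) =
      omega p ^ m • 1 := fun m => by
    simp [hz, smul_pow]
  have hω : omega p ^ p = 1 := by
    rw [omega, ← Complex.exp_nat_mul, mul_div_cancel₀ _ (Nat.cast_ne_zero.2 (NeZero.ne p)),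
      Complex.exp_two_pi_mul_I]
  have hη : ∀ η : SolutionGroup A b →* G,
      IsQuantumSolution η ↔ η (SolutionGroup.J A b) = ⟨z, hzG⟩ := fun η => by
    rw [IsQuantumSolution, ← inj]
    simp only [hz]
  simp only [hη, exists_hom_iff, ← hpow, inj]
  refine ⟨fun ⟨_, x, h1, _, h⟩ => ⟨x, h1, h⟩, fun ⟨x, h1, h⟩ => ⟨?_, x, h1, fun k => ?_, h⟩⟩
  · rw [← inj, hpow, hω]
    simp
  · rw [Commute, SemiconjBy, ← inj]
    simp [hz]

/-- A classical solution is the same as a solution vector of the linear system. -/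
theorem exists_isClassicalSolution_iff [NeZero p] :
    (∃ η : SolutionGroup A b →* Multiplicative (ZMod p), IsClassicalSolution η) ↔
      ∃ x : Fin s → ZMod p, A *ᵥ x = b := by
  have tors : ∀ g : Multiplicative (ZMod p), g ^ p = 1 := fun g => by
    rw [← ofAdd_toAdd g, ← ofAdd_nsmul]
    simp
  have row : ∀ (x : Fin s → ZMod p) (j : Fin r),
      (List.ofFn fun k => Multiplicative.ofAdd (x k) ^ (A j k).val).prod =
        Multiplicative.ofAdd ((A *ᵥ x) j) := by
    intro x j
    rw [List.prod_ofFn, Matrix.mulVec, dotProduct, ofAdd_sum]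
    refine Finset.prod_congr rfl fun k _ => ?_
    rw [← ofAdd_nsmul, nsmul_eq_mul, ZMod.natCast_zmod_val]
  have hb : ∀ j, (Multiplicative.ofAdd (1 : ZMod p)) ^ (b j).val = Multiplicative.ofAdd (b j) := by
    intro j
    rw [← ofAdd_nsmul, nsmul_eq_mul, ZMod.natCast_zmod_val, mul_one]
  refine (exists_hom_iff _).trans ⟨?_, ?_⟩
  · rintro ⟨-, x, -, -, -, h⟩
    refine ⟨fun k => (x k).toAdd, funext fun j => Multiplicative.ofAdd.injective ?_⟩
    rw [← row, ← hb, ← h]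
    simp
  · rintro ⟨x, h⟩
    refine ⟨tors _, fun k => Multiplicative.ofAdd (x k), fun k => tors _, fun k => ?_,
      fun j k l _ _ => ?_, fun j => ?_⟩
    · exact mul_comm (G := Multiplicative (ZMod p)) _ _
    · exact mul_comm (G := Multiplicative (ZMod p)) _ _
    · rw [row, h, hb]

end SolutionGroup

/-! ### Tensor powers of groups of unitaries -/

/-- The tensor product `U₁ ⊗ ⋯ ⊗ Uₙ`, acting on `(ℂ^ι)^{⊗ n} = ℂ^(ι^n)`, with matrix entries
`∏ᵢ (Uᵢ) (f i) (g i)`; it is a group homomorphism in the tuple `(U₁, …, Uₙ)`. -/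
def tensorHom (ι : Type) [Fintype ι] [DecidableEq ι] (n : ℕ) :
    (Fin n → Matrix.unitaryGroup ι ℂ) →* Matrix.unitaryGroup (Fin n → ι) ℂ := by
  have hmul : ∀ M N : Fin n → Matrix ι ι ℂ,
      (Matrix.of fun f g : Fin n → ι => ∏ i, (M i * N i) (f i) (g i)) =
        (Matrix.of fun f g : Fin n → ι => ∏ i, M i (f i) (g i)) *
          (Matrix.of fun f g : Fin n → ι => ∏ i, N i (f i) (g i)) := by
    intro M N
    ext f g
    simp only [Matrix.of_apply, Matrix.mul_apply, ← Finset.prod_mul_distrib]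
    rw [Finset.prod_univ_sum]
    simp
  have hone : (Matrix.of fun f g : Fin n → ι => ∏ i, (1 : Matrix ι ι ℂ) (f i) (g i)) = 1 := by
    ext f g
    simp only [Matrix.of_apply, Matrix.one_apply]
    rw [Finset.prod_ite_zero]
    simp [funext_iff]
  exact
    { toFun := fun U =>
        ⟨Matrix.of fun f g => ∏ i, (U i : Matrix ι ι ℂ) (f i) (g i), by
          rw [Matrix.mem_unitaryGroup_iff]
          have hstar : star (Matrix.of fun f g : Fin n → ι =>
              ∏ i, (U i : Matrix ι ι ℂ) (f i) (g i)) =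
              Matrix.of fun f g => ∏ i, (star (U i : Matrix ι ι ℂ)) (f i) (g i) := by
            ext f g
            simp [Matrix.star_apply]
          rw [hstar, ← hmul, ← hone]
          congr! 5 with f g i
          exact Matrix.mem_unitaryGroup_iff.mp (U i).2⟩
      map_one' := Subtype.ext hone
      map_mul' := fun U V => Subtype.ext (hmul (fun i => U i) (fun i => V i)) }

/-- The group `G^{⊗ n}` of all `U₁ ⊗ ⋯ ⊗ Uₙ` with `Uᵢ ∈ G`. -/
def tensorPower {ι : Type} [Fintype ι] [DecidableEq ι] (G : Subgroup (Matrix.unitaryGroup ι ℂ))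
    (n : ℕ) : Subgroup (Matrix.unitaryGroup (Fin n → ι) ℂ) :=
  (Subgroup.pi Set.univ fun _ : Fin n => G).map (tensorHom ι n)

/-! ### The group `L` -/

section L

variable (p : ℕ) [Fact p.Prime]

/-- The `p`-torsion part `T_(p)` of the diagonal maximal torus of `SU(p)`, given by the phase
functions `ξ : ℤ_p → U(1)` with `det S_ξ = ∏ ξ(q) = 1` and `S_ξ ^ p = 𝟙`. -/
def torsionTorus : Subgroup (ZMod p → Circle) where
  carrier := {ξ | ∏ q, ξ q = 1 ∧ ξ ^ p = 1}
  one_mem' := by simp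
  mul_mem' := by
    rintro ξ χ ⟨h1, h2⟩ ⟨h3, h4⟩
    exact ⟨by simp [Finset.prod_mul_distrib, h1, h3], by rw [mul_pow, h2, h4, one_mul]⟩
  inv_mem' := by
    rintro ξ ⟨h1, h2⟩
    exact ⟨by simp [h1], by rw [inv_pow, h2, inv_one]⟩

variable {p}

/-- The generalised phase gate `S_ξ |q⟩ = ξ(q) |q⟩`. -/
def phaseGate (ξ : ZMod p → Circle) : Matrix (ZMod p) (ZMod p) ℂ :=
  Matrix.diagonal fun q => (ξ q : ℂ)

/-- The permutation matrix `P_σ |q⟩ = |σ q⟩`. -/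
def permGate (σ : Equiv.Perm (ZMod p)) : Matrix (ZMod p) (ZMod p) ℂ :=
  Matrix.of fun i j => if i = σ j then 1 else 0

/-- The monomial matrix `ε(σ) S_ξ P_σ`, where `ε(σ) = ±1`. -/
def monomial (ε : Equiv.Perm (ZMod p) →* ℤˣ) (ξ : ZMod p → Circle) (σ : Equiv.Perm (ZMod p)) :
    Matrix (ZMod p) (ZMod p) ℂ :=
  (((ε σ : ℤˣ) : ℤ) : ℂ) • (phaseGate ξ * permGate σ)

theorem monomial_apply (ε : Equiv.Perm (ZMod p) →* ℤˣ) (ξ : ZMod p → Circle)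
    (σ : Equiv.Perm (ZMod p)) (i j : ZMod p) :
    monomial ε ξ σ i j = if i = σ j then (((ε σ : ℤˣ) : ℤ) : ℂ) * (ξ i : ℂ) else 0 := by
  simp [monomial, phaseGate, permGate, Matrix.diagonal_mul]

theorem monomial_one (ε : Equiv.Perm (ZMod p) →* ℤˣ) : monomial ε 1 1 = 1 := by
  ext i j
  simp [monomial_apply, Matrix.one_apply]

/-- The multiplication law `(ξ, σ) (χ, τ) = (ξ · (χ ∘ σ⁻¹), σ τ)` of the split extension. -/
theorem monomial_mul (ε : Equiv.Perm (ZMod p) →* ℤˣ) (ξ χ : ZMod p → Circle)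
    (σ τ : Equiv.Perm (ZMod p)) :
    monomial ε ξ σ * monomial ε χ τ = monomial ε (ξ * fun q => χ (σ⁻¹ q)) (σ * τ) := by
  ext i j
  rw [Matrix.mul_apply, Finset.sum_eq_single (τ j)]
  · simp only [monomial_apply, if_true, Equiv.Perm.mul_apply, map_mul]
    split_ifs with h
    · subst h
      simp
      ring
    · simp
  · intro k _ hk
    simp [monomial_apply, hk]
  · simp

theorem star_monomial (ε : Equiv.Perm (ZMod p) →* ℤˣ) (ξ : ZMod p → Circle)
    (σ : Equiv.Perm (ZMod p)) :
    star (monomial ε ξ σ) = monomial ε (fun q => (ξ (σ q))⁻¹) σ⁻¹ := by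
  ext i j
  simp only [Matrix.star_apply, monomial_apply, Equiv.Perm.eq_inv_iff_eq]
  by_cases h : σ i = j
  · subst h
    simp [← Circle.coe_inv_eq_conj]
  · simp [h, Ne.symm h]

/-- The group `L(p)`: the split extension of `T_(p)` by the symmetric group `S_p` on `ℤ_p`,
realised by the monomial unitary matrices `ε(σ) S_ξ P_σ` with `ξ ∈ T_(p)` and `σ ∈ S_p`.
The sign character `ε` of `S_p` is either trivial, in which case `S_p` is represented by
permutation matrices, or the signature, in which case `L(p) ≤ SU(p)` for `p` odd. -/
def groupL (ε : Equiv.Perm (ZMod p) →* ℤˣ) : Subgroup (Matrix.unitaryGroup (ZMod p) ℂ) where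
  carrier := {U | ∃ ξ ∈ torsionTorus p, ∃ σ : Equiv.Perm (ZMod p),
    (U : Matrix (ZMod p) (ZMod p) ℂ) = monomial ε ξ σ}
  one_mem' := ⟨1, one_mem _, 1, (monomial_one ε).symm⟩
  mul_mem' := by
    rintro U V ⟨ξ, hξ, σ, hU⟩ ⟨χ, hχ, τ, hV⟩
    have hχ' : (fun q => χ (σ⁻¹ q)) ∈ torsionTorus p :=
      ⟨(Equiv.prod_comp σ⁻¹ χ).trans hχ.1, funext fun q => congrFun hχ.2 (σ⁻¹ q)⟩
    refine ⟨_, mul_mem hξ hχ', σ * τ, ?_⟩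
    · rw [← monomial_mul, ← hU, ← hV]
      rfl
  inv_mem' := by
    rintro U ⟨ξ, hξ, σ, hU⟩
    have hξ' : (fun q => ξ (σ q)) ∈ torsionTorus p :=
      ⟨(Equiv.prod_comp σ ξ).trans hξ.1, funext fun q => congrFun hξ.2 (σ q)⟩
    refine ⟨_, inv_mem hξ', σ⁻¹, ?_⟩
    · change star (U : Matrix (ZMod p) (ZMod p) ℂ) = _
      rw [hU, star_monomial]
      rfl

end L

end LCS

end

/-! It suffices to find a map from `L^{⊗n}` to `ℤ_p` that sends `ω𝟙` to `1` and is additive on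
commuting pairs of `p`-torsion elements. It need not be a homomorphism: a linear system only
multiplies commuting operators, so applying the map to a quantum solution gives a solution vector
(`exists_isClassicalSolution_of_value`).

In one tensor factor, a permutation of `p` points with `σ ^ p = 1` is trivial or a `p`-cycle. For a
cycle, number the points along the orbit of `0`. Since `det S_ξ = 1`, the exponents of the phases
sum to `0`, so they are the differences `F m - F (m - 1)` of some `F` on `ℤ_p`; the value is the
linear coefficient of `F`. A monomial operator commuting with this one up to `ω ^ c` translates the
same orbit by some `b`, with exponents `F m - F (m - b) + l ± c m`, and its value can be computed
from `F`, `b`, `l`, `c` (`phaseValue_of_translation`). Comparing values shows additivity up to an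
error `c / 2` (`phaseValue_mul`).

Commuting tensor products commute in each factor up to phases `c i` with `∑ c i = 0`
(`IsLift.unique`), so the errors cancel in the sum over the factors. The sign `ε` plays no role, as
equal permutations carry equal signs. Conversely, the powers of `ω𝟙` form a copy of `ℤ_p` in
`L^{⊗n}`. -/

noncomputable section

namespace LCS

/-! ### Linear coefficients and discrete primitives on `ℤ_p`. -/

section PhaseValue

variable {p : ℕ} [Fact p.Prime]

/-- The coefficient of `X` in the polynomial of degree less than `p` which represents the function
`F` on `ℤ_p`, for `p` odd. -/
def linearCoeff (F : ZMod p → ZMod p) : ZMod p := -∑ m, F m * m⁻¹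

/-- The discrete primitive of `g`, normalised to vanish at `0`. -/
def primitive (g : ZMod p → ZMod p) (m : ZMod p) : ZMod p :=
  ∑ j ∈ Finset.range m.val, g (j + 1)

/-- The orbit of `0` under `σ`, parametrised by `ℤ_p`. -/
def orbit (σ : Equiv.Perm (ZMod p)) (m : ZMod p) : ZMod p := (σ ^ m.val) 0

/-- The exponent assigned to the monomial operator with phases `ω ^ e q` and permutation `σ`. It is
additive, up to half the commutator phase, on pairs of `p`-torsion operators which commute up to a
phase. -/
def phaseValue (e : ZMod p → ZMod p) (σ : Equiv.Perm (ZMod p)) : ZMod p :=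
  if σ = 1 then e 0 else linearCoeff (primitive fun m => e (orbit σ m))

theorem two_ne_zero_of_odd (hp : p ≠ 2) : (2 : ZMod p) ≠ 0 := by
  intro h
  have h2 : ((2 : ℕ) : ZMod p) = 0 := by exact_mod_cast h
  rw [ZMod.natCast_eq_zero_iff] at h2
  exact hp ((Nat.prime_dvd_prime_iff_eq Fact.out Nat.prime_two).1 h2)

theorem sum_zmod_eq_zero (hp : p ≠ 2) : ∑ m : ZMod p, m = 0 := by
  have h : ∑ m : ZMod p, m = -∑ m : ZMod p, m := by
    conv_lhs => rw [← Equiv.sum_comp (Equiv.neg (ZMod p))]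
    exact Finset.sum_neg_distrib _
  have h2 : (2 : ZMod p) * ∑ m : ZMod p, m = 0 := by linear_combination h
  exact (mul_eq_zero.1 h2).resolve_left (two_ne_zero_of_odd hp)

theorem linearCoeff_add (F G : ZMod p → ZMod p) :
    linearCoeff (fun m => F m + G m) = linearCoeff F + linearCoeff G := by
  simp only [linearCoeff, add_mul, Finset.sum_add_distrib]
  ring

theorem linearCoeff_mul_left (a : ZMod p) (F : ZMod p → ZMod p) :
    linearCoeff (fun m => a * F m) = a * linearCoeff F := by
  simp only [linearCoeff, mul_assoc, ← Finset.mul_sum]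
  ring

/-- Inversion, with `0⁻¹ = 0`, permutes `ℤ_p`, so the inverses sum to `∑ m = 0` for odd `p`. -/
theorem linearCoeff_const (hp : p ≠ 2) (a : ZMod p) : linearCoeff (fun _ => a) = 0 := by
  have h : ∑ m : ZMod p, m⁻¹ = ∑ m : ZMod p, m :=
    Equiv.sum_comp (⟨fun m => m⁻¹, fun m => m⁻¹, inv_inv, inv_inv⟩ : ZMod p ≃ ZMod p) fun m => m
  rw [linearCoeff, ← Finset.mul_sum, h, sum_zmod_eq_zero hp]
  simp

theorem linearCoeff_id : linearCoeff (fun m : ZMod p => m) = 1 := by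
  have h : ∀ m : ZMod p, m * m⁻¹ = 1 - if m = 0 then 1 else 0 := by
    intro m
    split_ifs with hm
    · simp [hm]
    · simp [mul_inv_cancel₀ hm]
  simp [linearCoeff, h]

theorem linearCoeff_sq (hp : p ≠ 2) : linearCoeff (fun m : ZMod p => m ^ 2) = 0 := by
  have h : ∀ m : ZMod p, m ^ 2 * m⁻¹ = m := by
    intro m
    by_cases hm : m = 0
    · simp [hm]
    · field_simp
  simp only [linearCoeff, h, sum_zmod_eq_zero hp, neg_zero]

theorem linearCoeff_comp_mul {b : ZMod p} (hb : b ≠ 0) (F : ZMod p → ZMod p) :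
    linearCoeff (fun m => F (b * m)) = b * linearCoeff F := by
  rw [linearCoeff, linearCoeff, mul_neg, Finset.mul_sum,
    ← Equiv.sum_comp (Equiv.mulLeft₀ b hb) fun m => b * (F m * m⁻¹)]
  congr 1
  refine Finset.sum_congr rfl fun m _ => ?_
  rw [show Equiv.mulLeft₀ b hb m = b * m from rfl, mul_inv]
  field_simp

theorem eq_add_primitive {G g : ZMod p → ZMod p} (h : ∀ m, G m - G (m - 1) = g m) (m : ZMod p) :
    G m = G 0 + primitive g m := by
  have key : ∀ k : ℕ, G k = G 0 + ∑ j ∈ Finset.range k, g (j + 1) := by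
    intro k
    induction k with
    | zero => simp
    | succ k ih =>
      have hk := h (k + 1)
      rw [add_sub_cancel_right] at hk
      rw [Finset.sum_range_succ, Nat.cast_succ]
      linear_combination hk + ih
  have hm := key m.val
  rwa [ZMod.natCast_zmod_val] at hm

theorem primitive_sub {g : ZMod p → ZMod p} (hg : ∑ m, g m = 0) (m : ZMod p) :
    primitive g m - primitive g (m - 1) = g m := by
  obtain ⟨q, rfl⟩ : ∃ q, p = q + 1 := ⟨p - 1, (Nat.succ_pred_prime Fact.out).symm⟩
  have hsum : ∑ j ∈ Finset.range (q + 1), g j = 0 := by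
    rw [← hg, ← Fin.sum_univ_eq_sum_range fun j => g (j : ZMod (q + 1))]
    exact Finset.sum_congr rfl fun j _ => congrArg g (ZMod.natCast_zmod_val (n := q + 1) j)
  obtain ⟨k, rfl⟩ : ∃ k : ZMod (q + 1), m = k + 1 := ⟨m - 1, by ring⟩
  rw [add_sub_cancel_right]
  by_cases hk : k.val + 1 < q + 1
  · have hval : (k + 1).val = k.val + 1 := by
      have := ZMod.val_natCast_of_lt hk
      rwa [Nat.cast_succ, ZMod.natCast_zmod_val] at this
    simp only [primitive, hval, Finset.sum_range_succ, ZMod.natCast_zmod_val]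
    ring
  -- The wrap-around from `p - 1` to `0` is the only place where the vanishing total is needed.
  · have hkq : k.val = q := by
      have := ZMod.val_lt k
      omega
    have h0 : k + 1 = 0 := by
      rw [← ZMod.natCast_zmod_val k, hkq, ← Nat.cast_succ, ZMod.natCast_self]
    rw [Finset.sum_range_succ'] at hsum
    simp only [Nat.cast_succ, Nat.cast_zero] at hsum
    simp only [primitive, h0, hkq, ZMod.val_zero, Finset.range_zero, Finset.sum_empty]
    linear_combination -hsum

/-- Primitives differ by constants, which have no linear term, so the normalisation at `0` is
immaterial. -/
theorem linearCoeff_primitive (hp : p ≠ 2) {G g : ZMod p → ZMod p}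
    (h : ∀ m, G m - G (m - 1) = g m) : linearCoeff (primitive g) = linearCoeff G := by
  rw [funext (eq_add_primitive h), linearCoeff_add, linearCoeff_const hp, zero_add]

/-- A constant phase `c` adds `c * m` to the primitive. This controls the scalar ambiguity of tensor
factors. -/
theorem phaseValue_add_const (e : ZMod p → ZMod p) (σ : Equiv.Perm (ZMod p))
    (c : ZMod p) : phaseValue (fun q => e q + c) σ = phaseValue e σ + c := by
  by_cases hσ : σ = 1
  · simp [phaseValue, hσ]
  · have h : (primitive fun m => e (orbit σ m) + c) =
        fun m => primitive (fun m => e (orbit σ m)) m + c * m := by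
      funext m
      simp [primitive, Finset.sum_add_distrib, mul_comm]
    simp only [phaseValue, hσ, if_false, h]
    rw [linearCoeff_add, linearCoeff_mul_left, linearCoeff_id, mul_one]

/-! ### Orbits of `p`-torsion permutations. -/

theorem orbit_eq {τ : Equiv.Perm (ZMod p)} {π : ZMod p → ZMod p} (h0 : π 0 = 0)
    (h : ∀ m, π (m + 1) = τ (π m)) (m : ZMod p) : orbit τ m = π m := by
  have key : ∀ k : ℕ, (τ ^ k) 0 = π k := by
    intro k
    induction k with
    | zero => simp [h0]
    | succ k ih => rw [pow_succ', Equiv.Perm.mul_apply, ih, Nat.cast_succ, h]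
  rw [orbit, key, ZMod.natCast_zmod_val]

theorem pow_apply_zero {σ : Equiv.Perm (ZMod p)} (hσ : σ ^ p = 1) (k : ℕ) :
    (σ ^ k) 0 = orbit σ k := by
  rw [orbit, ZMod.val_natCast]
  conv_lhs => rw [← Nat.mod_add_div k p, pow_add, pow_mul, hσ, one_pow, mul_one]

theorem orbit_zero (σ : Equiv.Perm (ZMod p)) : orbit σ 0 = 0 := by
  simp [orbit]

theorem pow_apply_orbit {σ : Equiv.Perm (ZMod p)} (hσ : σ ^ p = 1) (k : ℕ) (m : ZMod p) :
    (σ ^ k) (orbit σ m) = orbit σ (m + k) := by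
  have h : orbit σ (m + k) = orbit σ ((m.val + k : ℕ) : ZMod p) := by simp
  rw [h, ← pow_apply_zero hσ, orbit, ← Equiv.Perm.mul_apply, ← pow_add, add_comm]

theorem apply_orbit {σ : Equiv.Perm (ZMod p)} (hσ : σ ^ p = 1) (m : ZMod p) :
    σ (orbit σ m) = orbit σ (m + 1) := by
  simpa using pow_apply_orbit hσ 1 m

/-- A permutation of prime order `p` on `p` points is a single cycle with full support. -/
theorem orbit_bijective {σ : Equiv.Perm (ZMod p)} (hσ : σ ^ p = 1) (hσ1 : σ ≠ 1) :
    Function.Bijective (orbit σ) := by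
  refine Finite.surjective_iff_bijective.1 fun q => ?_
  have hord : orderOf σ = p := orderOf_eq_prime hσ hσ1
  have hcyc : σ.IsCycle := Equiv.Perm.isCycle_of_prime_order''
    (by rw [ZMod.card]; exact Fact.out) (by rw [ZMod.card, hord])
  have hsupp : σ.support = Finset.univ := by
    rw [← Finset.card_eq_iff_eq_univ, ← hcyc.orderOf, hord, ZMod.card]
  have hmem : ∀ x, σ x ≠ x := fun x => Equiv.Perm.mem_support.1 (by simp [hsupp])
  obtain ⟨k, hk⟩ := hcyc.exists_pow_eq (hmem 0) (hmem q)
  exact ⟨k, by rw [← pow_apply_zero hσ, hk]⟩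

/-! ### Additivity in one tensor factor. -/

/-- The value of `phaseValue` in coordinates adapted to a full orbit `π`, for a translation by `b`
along the orbit. -/
theorem phaseValue_of_translation (hp : p ≠ 2) {π : ZMod p → ZMod p} (h0 : π 0 = 0)
    (hπ : Function.Bijective π) {τ : Equiv.Perm (ZMod p)} {b : ZMod p}
    (hτ : ∀ m, τ (π m) = π (m + b)) {e F : ZMod p → ZMod p} {l s : ZMod p}
    (he : ∀ m, e (π m) = F m - F (m - b) + l + s * m) :
    phaseValue e τ = b * linearCoeff F + l + s * b / 2 := by
  have h2 := two_ne_zero_of_odd hp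
  by_cases hb : b = 0
  · subst hb
    have hτ1 : τ = 1 := Equiv.ext fun q => by
      obtain ⟨m, rfl⟩ := hπ.2 q
      rw [hτ, add_zero, Equiv.Perm.one_apply]
    have := he 0
    rw [h0] at this
    simp [phaseValue, hτ1, this]
  · have hτ1 : τ ≠ 1 := by
      rintro rfl
      refine hb (hπ.1 ?_)
      rw [← zero_add b, ← hτ, Equiv.Perm.one_apply]
    have horb : ∀ m, orbit τ m = π (b * m) :=
      orbit_eq (π := fun m => π (b * m)) (by simp [h0]) fun m => by
        rw [hτ, mul_add, mul_one]
    -- Along the orbit of `τ` the exponent has the affine part `l + s * b * m`, whose primitive is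
    -- quadratic. Its square term has no linear coefficient, which leaves `l + s * b / 2`.
    have hG : ∀ m : ZMod p,
        (F (b * m) + ((s * b / 2) * m ^ 2 + (l + s * b / 2) * m)) -
          (F (b * (m - 1)) + ((s * b / 2) * (m - 1) ^ 2 + (l + s * b / 2) * (m - 1))) =
        e (orbit τ m) := by
      intro m
      rw [horb, he, mul_sub, mul_one]
      field_simp
      ring
    rw [phaseValue, if_neg hτ1, linearCoeff_primitive hp hG, linearCoeff_add, linearCoeff_add,
      linearCoeff_comp_mul hb, linearCoeff_mul_left, linearCoeff_mul_left, linearCoeff_id,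
      linearCoeff_sq hp]
    ring

theorem phaseValue_mul_of_ne_one (hp : p ≠ 2) {e e' : ZMod p → ZMod p} {σ τ : Equiv.Perm (ZMod p)}
    {c : ZMod p} (he : ∑ q, e q = 0) (hσ : σ ^ p = 1) (hσ1 : σ ≠ 1) (hστ : Commute σ τ)
    (h : ∀ q, e q + e' (σ⁻¹ q) = e' q + e (τ⁻¹ q) + c) :
    phaseValue (fun q => e q + e' (σ⁻¹ q)) (σ * τ) = phaseValue e σ + phaseValue e' τ + c / 2 := by
  have h2 := two_ne_zero_of_odd hp
  have hπ := orbit_bijective hσ hσ1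
  have h0 := orbit_zero σ
  -- Commuting with the cycle `σ`, `τ` is determined by the image of `0`, hence is translation by
  -- `b` along the orbit.
  obtain ⟨b, hb⟩ := hπ.2 (τ 0)
  set π := orbit σ with hπdef
  have hσπ : ∀ m, σ (π m) = π (m + 1) := apply_orbit hσ
  have hτπ : ∀ m, τ (π m) = π (m + b) := by
    intro m
    have hm : π (m + b) = (σ ^ m.val) (π b) := by
      rw [pow_apply_orbit hσ, ZMod.natCast_zmod_val, add_comm]
    rw [hm, hb, ← Equiv.Perm.mul_apply, (hστ.pow_left m.val).eq]
    rfl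
  have hσπ' : ∀ m, σ⁻¹ (π m) = π (m - 1) := fun m => by
    rw [Equiv.Perm.inv_eq_iff_eq, hσπ, sub_add_cancel]
  have hτπ' : ∀ m, τ⁻¹ (π m) = π (m - b) := fun m => by
    rw [Equiv.Perm.inv_eq_iff_eq, hτπ, sub_add_cancel]
  set F := primitive fun m => e (π m)
  have hF : ∀ m, F m - F (m - 1) = e (π m) :=
    primitive_sub (by rw [← he]; exact hπ.sum_comp e)
  -- The defect of `e'` from being a difference of `F`; commutation up to the phase `c` forces it to
  -- be affine with slope `-c`.
  set d : ZMod p → ZMod p := fun m => e' (π m) - (F m - F (m - b)) with hd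
  have hd1 : ∀ m, d m - d (m - 1) = -c := by
    intro m
    have hm := h (π m)
    rw [hσπ', hτπ', ← hF, ← hF] at hm
    simp only [hd]
    rw [sub_right_comm m 1 b]
    linear_combination -hm
  have hdm : ∀ m, d m = d 0 + -c * m := by
    intro m
    have key := eq_add_primitive hd1 m
    simpa [primitive, mul_comm] using key
  have v1 : phaseValue e σ = 1 * linearCoeff F + 0 + 0 * 1 / 2 :=
    phaseValue_of_translation hp h0 hπ hσπ fun m => by rw [hF]; ring
  have v2 : phaseValue e' τ = b * linearCoeff F + d 0 + -c * b / 2 :=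
    phaseValue_of_translation hp h0 hπ hτπ fun m => by
      have := hdm m
      simp only [hd] at this ⊢
      linear_combination this
  have v3 : phaseValue (fun q => e q + e' (σ⁻¹ q)) (σ * τ) =
      (b + 1) * linearCoeff F + (d 0 + c) + -c * (b + 1) / 2 :=
    phaseValue_of_translation hp h0 hπ
      (fun m => by rw [Equiv.Perm.mul_apply, hτπ, hσπ, add_assoc]) fun m => by
        have := hdm (m - 1)
        rw [hσπ', ← hF, ← sub_sub, sub_right_comm m b 1]
        simp only [hd] at this ⊢
        linear_combination this
  rw [v1, v2, v3]
  field_simp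
  ring

/-- `phaseValue` is additive, up to half the commutator phase, on pairs of `p`-torsion monomial
operators which commute up to a phase. -/
theorem phaseValue_mul (hp : p ≠ 2) {e e' : ZMod p → ZMod p} {σ τ : Equiv.Perm (ZMod p)}
    {c : ZMod p} (he : ∑ q, e q = 0) (he' : ∑ q, e' q = 0) (hσ : σ ^ p = 1) (hτ : τ ^ p = 1)
    (hστ : Commute σ τ) (h : ∀ q, e q + e' (σ⁻¹ q) = e' q + e (τ⁻¹ q) + c) :
    phaseValue (fun q => e q + e' (σ⁻¹ q)) (σ * τ) = phaseValue e σ + phaseValue e' τ + c / 2 := by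
  have h2 := two_ne_zero_of_odd hp
  by_cases hσ1 : σ = 1
  · by_cases hτ1 : τ = 1
    · subst hσ1 hτ1
      have hc : c = 0 := by
        have := h 0
        simp only [inv_one, Equiv.Perm.one_apply] at this
        linear_combination -this
      simp [phaseValue, hc]
    -- Exchanging the factors turns `c` into `-c` and shifts the product's exponents by `c`; the net
    -- error `c - c / 2` is again `c / 2`.
    · have key := phaseValue_mul_of_ne_one (c := -c) hp he' hτ hτ1 hστ.symm fun q => by
        rw [h q]; ring
      rw [funext h, phaseValue_add_const, hστ.eq, key]
      field_simp
      ring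
  · exact phaseValue_mul_of_ne_one hp he hσ hσ1 hστ h

end PhaseValue
-- Factorwise descriptions of elements of `L^{⊗n}`.
section Lift

variable {p : ℕ} [Fact p.Prime] {n : ℕ} {ε : Equiv.Perm (ZMod p) →* ℤˣ}

/-- `x` is the tensor product of the monomial operators in `L` with phases `ω ^ e i q` and
permutations `σ i`. -/
def IsLift (ε : Equiv.Perm (ZMod p) →* ℤˣ) (x : Matrix.unitaryGroup (Fin n → ZMod p) ℂ)
    (e : Fin n → ZMod p → ZMod p) (σ : Fin n → Equiv.Perm (ZMod p)) : Prop :=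
  (∀ i, ∑ q, e i q = 0) ∧ ∃ U : Fin n → Matrix.unitaryGroup (ZMod p) ℂ,
    tensorHom (ZMod p) n U = x ∧
      ∀ i, (U i : Matrix (ZMod p) (ZMod p) ℂ) =
        monomial ε (fun q => ZMod.toCircle (e i q)) (σ i)

theorem exists_toCircle_eq {z : Circle} (hz : z ^ p = 1) : ∃ a : ZMod p, ZMod.toCircle a = z := by
  obtain ⟨a, ha⟩ := (bijective_rootsOfUnityAddChar p).2
    ⟨toUnits z, by rw [mem_rootsOfUnity, ← map_pow, hz, map_one]⟩
  refine ⟨a, ?_⟩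
  rw [← ZMod.rootsOfUnityAddChar_val, ha]
  rfl

theorem toCircle_sum {ι : Type*} (t : Finset ι) (a : ι → ZMod p) :
    ZMod.toCircle (∑ i ∈ t, a i) = ∏ i ∈ t, ZMod.toCircle (a i) := by
  classical
  induction t using Finset.induction_on with
  | empty => simp
  | insert i t hi ih => rw [Finset.sum_insert hi, Finset.prod_insert hi, AddChar.map_add_eq_mul, ih]

theorem coe_toCircle_sum {ι : Type*} (t : Finset ι) (a : ι → ZMod p) :
    ((ZMod.toCircle (∑ i ∈ t, a i) : Circle) : ℂ) =
      ∏ i ∈ t, ((ZMod.toCircle (a i) : Circle) : ℂ) := by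
  rw [toCircle_sum]
  exact map_prod Circle.coeHom _ t

theorem coe_toCircle_one : ((ZMod.toCircle (1 : ZMod p) : Circle) : ℂ) = omega p := by
  have h := ZMod.toCircle_natCast (N := p) 1
  rw [Nat.cast_one] at h
  rw [h, omega]
  simp

theorem exists_isLift {x : Matrix.unitaryGroup (Fin n → ZMod p) ℂ}
    (hx : x ∈ tensorPower (groupL ε) n) : ∃ e σ, IsLift ε x e σ := by
  obtain ⟨U, hU, rfl⟩ := hx
  have hU' : ∀ i, ∃ e : ZMod p → ZMod p, ∃ σ, ∑ q, e q = 0 ∧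
      (U i : Matrix (ZMod p) (ZMod p) ℂ) = monomial ε (fun q => ZMod.toCircle (e q)) σ := by
    intro i
    obtain ⟨ξ, ⟨hdet, hξ⟩, σ, h⟩ := hU i (Set.mem_univ i)
    choose e he using fun q => exists_toCircle_eq (congrFun hξ q)
    refine ⟨e, σ, ZMod.injective_toCircle ?_, by rw [h, funext he]⟩
    rw [toCircle_sum, AddChar.map_zero_eq_one, ← hdet]
    exact Finset.prod_congr rfl fun q _ => he q
  choose e σ he h using hU'
  exact ⟨e, σ, he, U, rfl, h⟩

theorem IsLift.mem {x : Matrix.unitaryGroup (Fin n → ZMod p) ℂ} {e : Fin n → ZMod p → ZMod p}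
    {σ : Fin n → Equiv.Perm (ZMod p)} (h : IsLift ε x e σ) : x ∈ tensorPower (groupL ε) n := by
  obtain ⟨he, U, rfl, hU⟩ := h
  refine ⟨U, fun i _ => ⟨_, ⟨?_, ?_⟩, σ i, hU i⟩, rfl⟩
  · rw [← toCircle_sum, he, AddChar.map_zero_eq_one]
  · funext q
    simp [← AddChar.map_nsmul_eq_pow]

theorem IsLift.mul {x y : Matrix.unitaryGroup (Fin n → ZMod p) ℂ} {e e' : Fin n → ZMod p → ZMod p}
    {σ τ : Fin n → Equiv.Perm (ZMod p)} (hx : IsLift ε x e σ) (hy : IsLift ε y e' τ) :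
    IsLift ε (x * y) (fun i q => e i q + e' i ((σ i)⁻¹ q)) (σ * τ) := by
  obtain ⟨he, U, rfl, hU⟩ := hx
  obtain ⟨he', V, rfl, hV⟩ := hy
  refine ⟨fun i => ?_, U * V, map_mul _ U V, fun i => ?_⟩
  · rw [Finset.sum_add_distrib, he, Equiv.sum_comp (σ i)⁻¹ (e' i), he', add_zero]
  · rw [Pi.mul_apply, Submonoid.coe_mul, hU, hV, monomial_mul]
    congr 1
    funext q
    simp [AddChar.map_add_eq_mul]

/-- The scalars `ω ^ ∑ᵢ a i`. -/
theorem isLift_scalar (ε : Equiv.Perm (ZMod p) →* ℤˣ)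
    {x : Matrix.unitaryGroup (Fin n → ZMod p) ℂ} {a : Fin n → ZMod p}
    (hx : (x : Matrix (Fin n → ZMod p) (Fin n → ZMod p) ℂ) =
      ((ZMod.toCircle (∑ i, a i) : Circle) : ℂ) • 1) : IsLift ε x (fun i _ => a i) 1 := by
  have hmon : ∀ i, monomial ε (fun _ => ZMod.toCircle (a i)) 1 =
      ((ZMod.toCircle (a i) : Circle) : ℂ) • (1 : Matrix (ZMod p) (ZMod p) ℂ) := by
    intro i
    ext q q'
    simp [monomial_apply, Matrix.one_apply]
  have hunit : ∀ i, monomial ε (fun _ => ZMod.toCircle (a i)) 1 ∈ Matrix.unitaryGroup (ZMod p) ℂ := by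
    intro i
    rw [Matrix.mem_unitaryGroup_iff, star_monomial, monomial_mul, mul_inv_cancel, ← monomial_one ε]
    congr 1
    funext q
    simp
  refine ⟨fun i => by simp, fun i => ⟨_, hunit i⟩, Subtype.ext ?_, fun i => rfl⟩
  rw [hx, coe_toCircle_sum]
  ext f g
  change ∏ i, monomial ε (fun _ => ZMod.toCircle (a i)) 1 (f i) (g i) = _
  simp only [hmon, Matrix.smul_apply, Matrix.one_apply, smul_eq_mul, Finset.prod_mul_distrib,
    Finset.prod_ite_zero]
  simp [funext_iff]

/-- A lift is unique up to scalars whose product is `1`. -/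
theorem IsLift.unique {x : Matrix.unitaryGroup (Fin n → ZMod p) ℂ}
    {e e' : Fin n → ZMod p → ZMod p} {σ τ : Fin n → Equiv.Perm (ZMod p)}
    (h : IsLift ε x e σ) (h' : IsLift ε x e' τ) :
    σ = τ ∧ ∃ c : Fin n → ZMod p, ∑ i, c i = 0 ∧ ∀ i q, e i q = e' i q + c i := by
  obtain ⟨-, U, rfl, hU⟩ := h
  obtain ⟨-, V, hVU, hV⟩ := h'
  have hentry : ∀ f g : Fin n → ZMod p,
      ∏ i, (U i : Matrix (ZMod p) (ZMod p) ℂ) (f i) (g i) =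
        ∏ i, (V i : Matrix (ZMod p) (ZMod p) ℂ) (f i) (g i) := fun f g =>
    congrArg (fun W : Matrix.unitaryGroup (Fin n → ZMod p) ℂ =>
      (W : Matrix (Fin n → ZMod p) (Fin n → ZMod p) ℂ) f g) hVU.symm
  simp only [hU, hV, monomial_apply] at hentry
  have hsign : ∀ σ : Equiv.Perm (ZMod p), (((ε σ : ℤˣ) : ℤ) : ℂ) ≠ 0 := fun σ =>
    Int.cast_ne_zero.2 (Units.ne_zero _)
  have hστ : σ = τ := by
    funext i
    ext q
    -- At this entry every factor on the left is nonzero, so no factor on the right may vanish.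
    have hq := hentry (fun i => σ i q) fun _ => q
    by_contra hne
    have h0 : (∏ i, if σ i q = τ i q then
        (((ε (τ i) : ℤˣ) : ℤ) : ℂ) * (ZMod.toCircle (e' i (σ i q)) : Circle) else 0) = 0 :=
      Finset.prod_eq_zero (Finset.mem_univ i) (if_neg fun h => hne (by rw [h]))
    rw [h0] at hq
    refine Finset.prod_ne_zero_iff.2 (fun i _ => ?_) hq
    rw [if_pos rfl]
    exact mul_ne_zero (hsign _) (Circle.coe_ne_zero _)
  subst hστ
  have hsum : ∀ f : Fin n → ZMod p, ∑ i, e i (f i) = ∑ i, e' i (f i) := by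
    intro f
    have hf := hentry f fun i => (σ i)⁻¹ (f i)
    have hinv : ∀ i, σ i ((σ i)⁻¹ (f i)) = f i := fun i => (σ i).apply_symm_apply (f i)
    simp only [hinv, if_true,
      Finset.prod_mul_distrib] at hf
    have hf := mul_left_cancel₀ (Finset.prod_ne_zero_iff.2 fun i _ => hsign _) hf
    refine ZMod.injective_toCircle ?_
    exact Circle.ext (by rw [coe_toCircle_sum, coe_toCircle_sum, hf])
  refine ⟨rfl, fun i => e i 0 - e' i 0, ?_, fun i q => ?_⟩
  · rw [Finset.sum_sub_distrib, hsum fun _ => 0, sub_self]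
  · have h1 := hsum fun _ => 0
    -- Moving one coordinate from `0` to `q` isolates a single factor and shows that `e i q - e' i
    -- q` does not depend on `q`.
    have h2 := hsum (Function.update (fun _ => 0) i q)
    rw [← Finset.add_sum_erase _ _ (Finset.mem_univ i),
      ← Finset.add_sum_erase (a := i) _ (fun i => e' i _) (Finset.mem_univ i)] at h1 h2
    have hupd : ∀ d : Fin n → ZMod p → ZMod p,
        ∑ j ∈ Finset.univ.erase i, d j (Function.update (fun _ => (0 : ZMod p)) i q j) =
          ∑ j ∈ Finset.univ.erase i, d j 0 := fun d =>
      Finset.sum_congr rfl fun j hj => by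
        rw [Function.update_of_ne (Finset.ne_of_mem_erase hj)]
    rw [hupd, hupd, Function.update_self] at h2
    linear_combination h2 - h1

theorem IsLift.pow_perm {x : Matrix.unitaryGroup (Fin n → ZMod p) ℂ}
    {e : Fin n → ZMod p → ZMod p} {σ : Fin n → Equiv.Perm (ZMod p)} (h : IsLift ε x e σ) (k : ℕ) :
    ∃ e', IsLift ε (x ^ k) e' (σ ^ k) := by
  induction k with
  | zero => exact ⟨fun _ _ => 0, isLift_scalar (a := 0) ε (by simp)⟩
  | succ k ih =>
    obtain ⟨e', h'⟩ := ih
    exact ⟨_, pow_succ x k ▸ pow_succ σ k ▸ h'.mul h⟩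

theorem IsLift.perm_pow_eq_one {x : Matrix.unitaryGroup (Fin n → ZMod p) ℂ}
    {e : Fin n → ZMod p → ZMod p} {σ : Fin n → Equiv.Perm (ZMod p)} (h : IsLift ε x e σ)
    (hx : x ^ p = 1) (i : Fin n) : σ i ^ p = 1 := by
  obtain ⟨e', h'⟩ := h.pow_perm p
  rw [hx] at h'
  exact congrFun (h'.unique (isLift_scalar (a := 0) ε (by simp))).1 i

/-! ### The value on `L^{⊗n}`. -/

variable (ε) in
/-- The exponent assigned to an element of `L^{⊗ n}`. -/
def tensorValue (x : tensorPower (groupL ε) n) : ZMod p :=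
  ∑ i, phaseValue ((exists_isLift x.2).choose i) ((exists_isLift x.2).choose_spec.choose i)

/-- The chosen lift is irrelevant: another one changes the summands by constants that sum to `0`. -/
theorem IsLift.tensorValue_eq {x : tensorPower (groupL ε) n} {e : Fin n → ZMod p → ZMod p}
    {σ : Fin n → Equiv.Perm (ZMod p)} (h : IsLift ε x.1 e σ) :
    tensorValue ε x = ∑ i, phaseValue (e i) (σ i) := by
  obtain ⟨hσ, c, hc, he⟩ := (exists_isLift x.2).choose_spec.choose_spec.unique h
  rw [tensorValue]
  simp only [hσ, fun i => funext (he i), phaseValue_add_const, Finset.sum_add_distrib, hc, add_zero]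

theorem tensorValue_scalar {x : tensorPower (groupL ε) n} {a : Fin n → ZMod p}
    (hx : (x.1 : Matrix (Fin n → ZMod p) (Fin n → ZMod p) ℂ) =
      ((ZMod.toCircle (∑ i, a i) : Circle) : ℂ) • 1) : tensorValue ε x = ∑ i, a i := by
  rw [(isLift_scalar ε hx).tensorValue_eq]
  simp [phaseValue]

theorem tensorValue_mul (hp : p ≠ 2) {x y : tensorPower (groupL ε) n} (hx : x ^ p = 1)
    (hy : y ^ p = 1) (hxy : Commute x y) :
    tensorValue ε (x * y) = tensorValue ε x + tensorValue ε y := by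
  obtain ⟨e, σ, h⟩ := exists_isLift x.2
  obtain ⟨e', τ, h'⟩ := exists_isLift y.2
  -- The products in both orders lift the same element; comparing them yields the commutator phases
  -- `c i` of the factors, with sum `0`.
  have hyx := h'.mul h
  rw [← Subgroup.coe_mul, ← hxy.eq] at hyx
  obtain ⟨hστ, c, hc, hcomm⟩ := (h.mul h').unique hyx
  have hxσ := h.perm_pow_eq_one (congrArg Subtype.val hx)
  have hyτ := h'.perm_pow_eq_one (congrArg Subtype.val hy)
  have hxy' : IsLift ε (x * y).1 _ _ := h.mul h'
  rw [hxy'.tensorValue_eq, h.tensorValue_eq, h'.tensorValue_eq]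
  have key := fun i => phaseValue_mul hp (h.1 i) (h'.1 i) (hxσ i) (hyτ i) (congrFun hστ i) (hcomm i)
  simp only [Pi.mul_apply, key, Finset.sum_add_distrib, ← Finset.sum_div, hc, zero_div, add_zero]

end Lift

/-! ### From a partially additive value to a classical solution. -/

/-- A function which is additive on commuting pairs of `p`-torsion elements is additive on products
of lists of pairwise commuting `p`-torsion elements. -/
theorem map_list_prod_of_commute {G M : Type*} [Group G] [AddGroup M] {p : ℕ} {v : G → M}
    (hv : ∀ x y : G, x ^ p = 1 → y ^ p = 1 → Commute x y → v (x * y) = v x + v y) :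
    ∀ l : List G, (∀ x ∈ l, x ^ p = 1) → (∀ x ∈ l, ∀ y ∈ l, Commute x y) →
      l.prod ^ p = 1 ∧ v l.prod = (l.map v).sum
  | [], _, _ => by
    have h := hv 1 1 (one_pow p) (one_pow p) (Commute.refl 1)
    rw [mul_one] at h
    simpa using left_eq_add.1 h
  | x :: l, hl, hc => by
    obtain ⟨h1, h2⟩ := map_list_prod_of_commute hv l
      (fun y hy => hl y (List.mem_cons_of_mem x hy)) fun y hy z hz =>
        hc y (List.mem_cons_of_mem x hy) z (List.mem_cons_of_mem x hz)
    have hx := hl x List.mem_cons_self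
    have hxl : Commute x l.prod := Commute.list_prod_right l x fun y hy =>
      hc x List.mem_cons_self y (List.mem_cons_of_mem x hy)
    rw [List.prod_cons, List.map_cons, List.sum_cons, hv _ _ hx h1 hxl, h2, hxl.mul_pow, hx, h1]
    exact ⟨mul_one 1, rfl⟩

/-- A quantum solution in a group with a function to `ℤ_p` which is additive on commuting pairs of
`p`-torsion elements, and maps the image of `J` to `1`, yields a classical solution. -/
theorem exists_isClassicalSolution_of_value {p r s : ℕ} [NeZero p]
    {A : Matrix (Fin r) (Fin s) (ZMod p)} {b : Fin r → ZMod p} {G : Type*} [Group G]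
    (η : SolutionGroup A b →* G) {v : G → ZMod p}
    (hv : ∀ x y : G, x ^ p = 1 → y ^ p = 1 → Commute x y → v (x * y) = v x + v y)
    (hJ : v (η (SolutionGroup.J A b)) = 1) :
    ∃ θ : SolutionGroup A b →* Multiplicative (ZMod p), IsClassicalSolution θ := by
  rw [exists_isClassicalSolution_iff]
  obtain ⟨hz, x, hx, -, hcomm, hrow⟩ := (exists_hom_iff _).1 ⟨η, rfl⟩
  have hpow : ∀ g : G, g ^ p = 1 → ∀ k : ℕ, v (g ^ k) = k * v g := by
    intro g hg k
    have h := (map_list_prod_of_commute hv (List.replicate k g)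
      (fun y hy => by rwa [List.eq_of_mem_replicate hy])
      (fun y hy z hz => by rw [List.eq_of_mem_replicate hy, List.eq_of_mem_replicate hz])).2
    simpa using h
  refine ⟨fun k => v (x k), funext fun j => ?_⟩
  have h := (map_list_prod_of_commute hv (List.ofFn fun k => x k ^ (A j k).val) ?_ ?_).2
  · rw [hrow, hpow _ hz, hJ, List.map_ofFn, List.sum_ofFn, ZMod.natCast_zmod_val, mul_one] at h
    rw [h, Matrix.mulVec, dotProduct]
    refine Finset.sum_congr rfl fun k _ => ?_
    rw [Function.comp_apply, hpow _ (hx k), ZMod.natCast_zmod_val]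
  · simp only [List.forall_mem_ofFn_iff]
    intro k
    rw [← pow_mul, mul_comm, pow_mul, hx, one_pow]
  · simp only [List.forall_mem_ofFn_iff]
    intro k l
    -- A variable absent from the row enters with exponent `0`, so as the identity.
    by_cases hk : A j k = 0
    · simp [hk]
    by_cases hl : A j l = 0
    · simp [hl]
    exact (hcomm j k l hk hl).pow_pow _ _

end LCS

end

/-! ### The equivalence. -/

theorem mainTheorem7 (p : ℕ) [Fact p.Prime] (hp : p ≠ 2) (n : ℕ) (hn : 1 ≤ n)
    (ε : Equiv.Perm (ZMod p) →* ℤˣ) (r s : ℕ)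
    (A : Matrix (Fin r) (Fin s) (ZMod p)) (b : Fin r → ZMod p) :
    (∃ η : LCS.SolutionGroup A b →* LCS.tensorPower (LCS.groupL ε) n,
        LCS.IsQuantumSolution η) ↔
      ∃ η : LCS.SolutionGroup A b →* Multiplicative (ZMod p), LCS.IsClassicalSolution η := by
  -- The scalar `ω𝟙` is written with all of its phase in the first tensor factor, which exists
  -- because `n ≥ 1`.
  have hsum : ∑ i, Pi.single (⟨0, hn⟩ : Fin n) (1 : ZMod p) i = 1 := by simp
  constructor
  · rintro ⟨η, hη⟩
    refine LCS.exists_isClassicalSolution_of_value η (v := LCS.tensorValue ε)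
      (fun x y hx hy hxy => LCS.tensorValue_mul hp hx hy hxy) ?_
    rw [LCS.tensorValue_scalar (a := Pi.single ⟨0, hn⟩ 1), hsum]
    rw [hsum, LCS.coe_toCircle_one]
    exact hη
  · rintro ⟨θ, hθ⟩
    have hz : LCS.omega p • (1 : Matrix (Fin n → ZMod p) (Fin n → ZMod p) ℂ) ∈
        Matrix.unitaryGroup (Fin n → ZMod p) ℂ := by
      rw [← LCS.coe_toCircle_one, Matrix.mem_unitaryGroup_iff]
      simp [star_smul, smul_smul, ← Circle.coe_inv_eq_conj]
    have hmem : (⟨_, hz⟩ : Matrix.unitaryGroup (Fin n → ZMod p) ℂ) ∈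
        LCS.tensorPower (LCS.groupL ε) n :=
      (LCS.isLift_scalar (a := Pi.single ⟨0, hn⟩ 1) ε
        (by rw [hsum, LCS.coe_toCircle_one])).mem
    set z : LCS.tensorPower (LCS.groupL ε) n := ⟨_, hmem⟩ with hzdef
    have hzp : z ^ p = 1 := by
      refine Subtype.ext (Subtype.ext ?_)
      simp [hzdef, smul_pow, ← LCS.coe_toCircle_one, ← Circle.coe_pow, ← AddChar.map_nsmul_eq_pow]
    let ψ : {f : ℤ →+ Additive (LCS.tensorPower (LCS.groupL ε) n) // f p = 0} :=
      ⟨zmultiplesHom _ (Additive.ofMul z), by simpa [← ofMul_pow] using hzp⟩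
    let φ : Multiplicative (ZMod p) →* LCS.tensorPower (LCS.groupL ε) n :=
      AddMonoidHom.toMultiplicativeLeft (ZMod.lift p ψ)
    have hφ : φ (Multiplicative.ofAdd 1) = z := by
      have h := ZMod.lift_coe p ψ 1
      rw [Int.cast_one] at h
      exact congrArg Additive.toMul (h.trans (one_zsmul _))
    refine ⟨φ.comp θ, ?_⟩
    rw [LCS.IsQuantumSolution, MonoidHom.comp_apply, hθ, hφ]
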